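/- Throughout, a binary-input symmetric channel $W$ consists of a finite output alphabet $\mathcal Y$ and transition probabilities $W(y\mid x)$, $x\in\{0,1\}$, $y\in\mathcal Y$ (each $W(\cdot\mid x)$ being a probability distribution on $\mathcal Y$), for which there is a map $\sigma:\mathcal Y\to\mathcal Y$ with $\sigma=\sigma^{-1}$ and $W(y\mid 0)=W(\sigma(y)\mid 1)$ for all $y$. Write $I(W)=I(X;Y)$ for the mutual information, in bits, between a uniformly distributed input bit $X$ and the corresponding output $Y$, and $Z(W)=\sum_{y\in\mathcal Y}\sqrt{W(y\mid 0)W(y\mid 1)}$ for the Bhattacharyya parameter. Put $$W^-(y_1,y_2\mid x_1)=\sum_{x_2\in\{0,1\}}\tfrac12 W(y_1\mid x_1\oplus x_2)W(y_2\mid x_2),\qquad W^+(y_1,y_2,x_1\mid x_2)=\tfrac12 W(y_1\mid x_1\oplus x_2)W(y_2\mid x_2),$$ and define the channels $W_n^{(i)}$, $0\le i\le 2^n-1$, by $W_0^{(0)}=W$ and $W_{n+1}^{(i)}=(W_n^{(\lfloor i/2\rfloor)})^-$ for even $i$, $W_{n+1}^{(i)}=(W_n^{(\lfloor i/2\rfloor)})^+$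 for odd $i$. **Proposition.** There is an absolute constant $\Lambda\in(0,1)$ such that the following holds. For every $\rho\in(\Lambda,1)$ there is a constant $b_\rho>0$, depending only on $\rho$, such that for every binary-input symmetric channel $W$, every $\varepsilon>0$ and every integer $m\ge 0$ with $m\ge b_\rho\log(1/\varepsilon)$, there is a set $\mathcal W_r\subseteq\{W_m^{(i)}:0\le i\le 2^m-1\}$ such that $Z(M)\le 2\rho^m$ for all $M\in\mathcal W_r$ and $$\Pr_i\left[W_m^{(i)}\in\mathcal W_r\right]\ \ge\ I(W)-\varepsilon ,$$ where $i$ is uniformly distributed on $\{0,1,\dots,2^m-1\}$. -/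

import Mathlib

universe u

/-- A channel with input alphabet `{0, 1}` (encoded as `Bool`, `0 = false`, `1 = true`) and
a finite output alphabet `Out`; `prob x y` is the transition probability `W(y | x)`. -/
structure BinaryChannel where
  /-- the output alphabet -/
  Out : Type u
  [fintypeOut : Fintype Out]
  /-- the transition probabilities `W(y | x)` -/
  prob : Bool → Out → ℝ
  prob_nonneg : ∀ x y, 0 ≤ prob x y
  sum_prob : ∀ x, ∑ y, prob x y = 1

attribute [instance] BinaryChannel.fintypeOut

noncomputable section

namespace BinaryChannel

/-- A binary-input channel is symmetric if some involution `σ` of the output alphabet satisfies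
`W(y | 0) = W(σ y | 1)` for all `y`. -/
def IsSymmetric (W : BinaryChannel.{u}) : Prop :=
  ∃ σ : W.Out → W.Out, Function.Involutive σ ∧ ∀ y, W.prob false y = W.prob true (σ y)

/-- Joint law of `(X, Y)`, with `X` a uniform input bit and `Y` the corresponding output. -/
def joint (W : BinaryChannel.{u}) (x : Bool) (y : W.Out) : ℝ :=
  1 / 2 * W.prob x y

/-- Law of the input `X`. -/
def inputLaw (W : BinaryChannel.{u}) (x : Bool) : ℝ :=
  ∑ y, W.joint x y

/-- Law of the output `Y`. -/
def outputLaw (W : BinaryChannel.{u}) (y : W.Out) : ℝ :=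
  ∑ x, W.joint x y

/-- The mutual information `I(X; Y)` in bits, for a uniform input `X`. Terms with
`joint x y = 0` vanish, and the two laws in the denominator are positive in all others. -/
def mutualInfo (W : BinaryChannel.{u}) : ℝ :=
  ∑ x, ∑ y, W.joint x y * Real.logb 2 (W.joint x y / (W.inputLaw x * W.outputLaw y))

/-- The Bhattacharyya parameter `Z(W) = ∑ y, √(W(y | 0) W(y | 1))`. -/
def bhattacharyya (W : BinaryChannel.{u}) : ℝ :=
  ∑ y, Real.sqrt (W.prob false y * W.prob true y)

/-- The transform `W⁻(y₁, y₂ | x₁) = ∑ x₂, 1/2 * W(y₁ | x₁ ⊕ x₂) * W(y₂ | x₂)`. -/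
def minus (W : BinaryChannel.{u}) : BinaryChannel.{u} where
  Out := W.Out × W.Out
  prob x₁ y := ∑ x₂ : Bool, 1 / 2 * W.prob (xor x₁ x₂) y.1 * W.prob x₂ y.2
  prob_nonneg x₁ y := Finset.sum_nonneg fun x₂ _ =>
    mul_nonneg (mul_nonneg (by norm_num) (W.prob_nonneg _ _)) (W.prob_nonneg _ _)
  sum_prob x₁ := by
    rw [Finset.sum_comm]
    simp only [Fintype.sum_prod_type, ← Finset.mul_sum, W.sum_prob, mul_one, Fintype.sum_bool]
    norm_num

/-- The transform `W⁺(y₁, y₂, x₁ | x₂) = 1/2 * W(y₁ | x₁ ⊕ x₂) * W(y₂ | x₂)`. -/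
def plus (W : BinaryChannel.{u}) : BinaryChannel.{u} where
  Out := W.Out × W.Out × Bool
  prob x₂ y := 1 / 2 * W.prob (xor y.2.2 x₂) y.1 * W.prob x₂ y.2.1
  prob_nonneg x₂ y :=
    mul_nonneg (mul_nonneg (by norm_num) (W.prob_nonneg _ _)) (W.prob_nonneg _ _)
  sum_prob x₂ := by
    have h : ∀ c : Bool, ∑ a, ∑ b, 1 / 2 * W.prob (xor c x₂) a * W.prob x₂ b = 1 / 2 := by
      intro c
      simp only [← Finset.mul_sum, W.sum_prob, mul_one]
    simp only [Fintype.sum_prod_type, Fintype.sum_bool, Finset.sum_add_distrib, h]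
    norm_num

/-- The polarized channels `W_n^{(i)}` (for `0 ≤ i < 2 ^ n`): `W_0^{(0)} = W`, and `W_{n+1}^{(i)}`
is the minus (`i` even) or plus (`i` odd) transform of `W_n^{(⌊i/2⌋)}`. -/
def polar (W : BinaryChannel.{u}) : ℕ → ℕ → BinaryChannel.{u}
  | 0, _ => W
  | n + 1, i => if Even i then (polar W n (i / 2)).minus else (polar W n (i / 2)).plus

end BinaryChannel

end

/-!
The argument runs on two parameters of a channel, the mutual information `I` and the Bhattacharyya
parameter `Z`.

* `I` is conserved on average: `I(W⁻) + I(W⁺) = 2 I(W)` (`mutualInfo_minus_add_plus`), so `I(W)` is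
  the mean of `I` over the `2 ^ m` channels at depth `m`.
* The potential `φ(Z) = √(Z (1 - Z))` contracts on average by the factor `√(39/40)`
  (`potential_minus_add_plus_le`). This follows from `Z(W⁺) = Z²` and
  `Z √(2 - Z²) ≤ Z(W⁻) ≤ 2 Z - Z²`; the lower bound on `Z(W⁻)`, which matters when `Z` is near `1`,
  is Minkowski's inequality in the plane applied twice. So the mean of `φ(Z)` at depth `m` is at
  most `√(39/40) ^ m / 2`.
* `I ≤ 1`, and `I ≤ 4 (1 - Z)` because the Kullback–Leibler divergence is at most the `χ²`
  divergence (`mutualInfo_le_four_mul`).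

A channel with `Z > 2 ρ ^ m` therefore has `I ≤ 2 √(1 - Z) ≤ 2 φ(Z) / √(ρ ^ m)`. Averaging `I` over
depth `m`, the channels with `Z ≤ 2 ρ ^ m` contribute at most their proportion and the others at
most `√((39/40) / ρ) ^ m`. For `ρ > 39/40` this decays exponentially in `m`, and it is below `ε` as
soon as `m ≥ 2 log (1/ε) / log (ρ / (39/40))`.
-/

open Finset

namespace BinaryChannel

/-! ### Mutual information -/

theorem inputLaw_eq (W : BinaryChannel.{u}) (x : Bool) : W.inputLaw x = 1 / 2 := by
  simp only [inputLaw, joint, ← mul_sum, W.sum_prob, mul_one]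

theorem outputLaw_eq (W : BinaryChannel.{u}) (y : W.Out) :
    W.outputLaw y = (W.prob false y + W.prob true y) / 2 := by
  simp only [outputLaw, joint, Fintype.sum_bool]
  ring

theorem sum_outputLaw (W : BinaryChannel.{u}) : ∑ y, W.outputLaw y = 1 := by
  simp only [outputLaw_eq, ← sum_div, sum_add_distrib, W.sum_prob]
  norm_num

theorem outputLaw_nonneg (W : BinaryChannel.{u}) (y : W.Out) : 0 ≤ W.outputLaw y := by
  rw [outputLaw_eq]
  linarith [W.prob_nonneg false y, W.prob_nonneg true y]

theorem prob_le_two_mul_outputLaw (W : BinaryChannel.{u}) (x : Bool) (y : W.Out) :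
    W.prob x y ≤ 2 * W.outputLaw y := by
  rw [outputLaw_eq]
  cases x <;> linarith [W.prob_nonneg false y, W.prob_nonneg true y]

theorem mutualInfo_eq_sum (W : BinaryChannel.{u}) :
    W.mutualInfo
      = ∑ y, ∑ x, 1 / 2 * W.prob x y * Real.logb 2 (W.prob x y / W.outputLaw y) := by
  rw [mutualInfo, sum_comm]
  refine sum_congr rfl fun y _ => sum_congr rfl fun x _ => ?_
  rw [inputLaw_eq, joint, mul_div_mul_left _ _ (by norm_num : (1 / 2 : ℝ) ≠ 0)]

/-- `I(X; Y) = H(Y) - H(Y | X)`, measured in nats. -/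
theorem mutualInfo_mul_log_two (W : BinaryChannel.{u}) :
    W.mutualInfo * Real.log 2
      = ∑ y, Real.negMulLog (W.outputLaw y)
        - 1 / 2 * ∑ x, ∑ y, Real.negMulLog (W.prob x y) := by
  have hlog : Real.log 2 ≠ 0 := (Real.log_pos (by norm_num)).ne'
  have key : ∀ (y : W.Out) (x : Bool),
      1 / 2 * W.prob x y * Real.logb 2 (W.prob x y / W.outputLaw y) * Real.log 2
        = -(1 / 2 * Real.negMulLog (W.prob x y))
          - 1 / 2 * W.prob x y * Real.log (W.outputLaw y) := by
    intro y x
    rcases (W.prob_nonneg x y).eq_or_lt' with h | h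
    · simp [h]
    · have ho : 0 < W.outputLaw y := by linarith [W.prob_le_two_mul_outputLaw x y]
      rw [Real.logb, mul_assoc, div_mul_cancel₀ _ hlog, Real.log_div h.ne' ho.ne', Real.negMulLog]
      ring
  rw [mutualInfo_eq_sum, sum_mul]
  simp only [sum_mul, key]
  rw [sum_comm (s := (univ : Finset Bool)), mul_sum, ← sum_sub_distrib]
  refine sum_congr rfl fun y _ => ?_
  rw [Real.negMulLog, outputLaw_eq]
  simp only [Fintype.sum_bool]
  ring

theorem outputLaw_minus (W : BinaryChannel.{u}) (y : W.Out × W.Out) :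
    W.minus.outputLaw y = W.outputLaw y.1 * W.outputLaw y.2 := by
  simp only [outputLaw_eq, minus, Fintype.sum_bool, Bool.xor_true, Bool.xor_false, Bool.not_true,
    Bool.not_false]
  ring

theorem outputLaw_plus (W : BinaryChannel.{u}) (y : W.Out × W.Out × Bool) :
    W.plus.outputLaw y = 1 / 2 * W.minus.prob y.2.2 (y.1, y.2.1) := by
  simp only [outputLaw_eq, minus, plus, Fintype.sum_bool, Bool.xor_true, Bool.xor_false]
  ring

theorem negMulLog_half_mul (t : ℝ) :
    Real.negMulLog (1 / 2 * t) = 1 / 2 * Real.negMulLog t + t * (Real.log 2 / 2) := by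
  rw [Real.negMulLog_mul, Real.negMulLog]
  simp only [one_div, Real.log_inv]
  ring

/-- Entropy is additive on product laws. -/
theorem sum_negMulLog_mul {α β : Type*} [Fintype α] [Fintype β] (f : α → ℝ) (g : β → ℝ)
    (hf : ∑ a, f a = 1) (hg : ∑ b, g b = 1) :
    ∑ a, ∑ b, Real.negMulLog (f a * g b)
      = ∑ a, Real.negMulLog (f a) + ∑ b, Real.negMulLog (g b) := by
  simp only [Real.negMulLog_mul, sum_add_distrib, ← mul_sum, ← sum_mul, hf, hg, one_mul]

theorem sum_negMulLog_plus (W : BinaryChannel.{u}) :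
    ∑ x, ∑ y, Real.negMulLog (W.plus.prob x y)
      = 2 * (∑ x, ∑ y, Real.negMulLog (W.prob x y)) + 2 * Real.log 2 := by
  have h : ∀ x₁ x₂ : Bool,
      ∑ y₁, ∑ y₂, Real.negMulLog (1 / 2 * (W.prob x₁ y₁ * W.prob x₂ y₂))
        = 1 / 2 * (∑ y, Real.negMulLog (W.prob x₁ y) + ∑ y, Real.negMulLog (W.prob x₂ y))
          + Real.log 2 / 2 := by
    intro x₁ x₂
    simp only [negMulLog_half_mul, sum_add_distrib, ← mul_sum, ← sum_mul, W.sum_prob, mul_one,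
      sum_negMulLog_mul _ _ (W.sum_prob x₁) (W.sum_prob x₂), one_mul]
  have h' : ∀ x, ∑ y, Real.negMulLog (W.plus.prob x y)
      = ∑ c : Bool, ∑ y₁, ∑ y₂,
          Real.negMulLog (1 / 2 * (W.prob (xor c x) y₁ * W.prob x y₂)) := by
    intro x
    change ∑ y : W.Out × W.Out × Bool,
      Real.negMulLog (1 / 2 * W.prob (xor y.2.2 x) y.1 * W.prob x y.2.1) = _
    simp only [Fintype.sum_prod_type, Fintype.sum_bool, sum_add_distrib, mul_assoc]
  simp only [h', h, Fintype.sum_bool, Bool.xor_true, Bool.xor_false, Bool.not_true, Bool.not_false]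
  ring

/-- The chain rule: the two transforms preserve the total mutual information. -/
theorem mutualInfo_minus_add_plus (W : BinaryChannel.{u}) :
    W.minus.mutualInfo + W.plus.mutualInfo = 2 * W.mutualInfo := by
  have hlog : Real.log 2 ≠ 0 := (Real.log_pos (by norm_num)).ne'
  have hminus : ∑ y, Real.negMulLog (W.minus.outputLaw y)
      = 2 * ∑ y, Real.negMulLog (W.outputLaw y) := by
    rw [show ∑ y, Real.negMulLog (W.minus.outputLaw y)
        = ∑ y : W.Out × W.Out, Real.negMulLog (W.outputLaw y.1 * W.outputLaw y.2) from
      sum_congr rfl fun y _ => congrArg Real.negMulLog (W.outputLaw_minus y)]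
    rw [Fintype.sum_prod_type, sum_negMulLog_mul _ _ W.sum_outputLaw W.sum_outputLaw]
    ring
  have hplus : ∑ y, Real.negMulLog (W.plus.outputLaw y)
      = 1 / 2 * (∑ x, ∑ y, Real.negMulLog (W.minus.prob x y)) + Real.log 2 := by
    have h1 : ∑ y, Real.negMulLog (W.plus.outputLaw y)
        = ∑ x, ∑ y, Real.negMulLog (1 / 2 * W.minus.prob x y) := by
      rw [show ∑ y, Real.negMulLog (W.plus.outputLaw y)
          = ∑ y : W.Out × W.Out × Bool,
            Real.negMulLog (1 / 2 * W.minus.prob y.2.2 (y.1, y.2.1)) from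
        sum_congr rfl fun y _ => congrArg Real.negMulLog (W.outputLaw_plus y)]
      change _ = ∑ x, ∑ y : W.Out × W.Out, Real.negMulLog (1 / 2 * W.minus.prob x y)
      simp only [Fintype.sum_prod_type, Fintype.sum_bool, sum_add_distrib]
    rw [h1]
    simp only [negMulLog_half_mul, sum_add_distrib, ← mul_sum, ← sum_mul, W.minus.sum_prob,
      Fintype.sum_bool]
    ring
  apply mul_right_cancel₀ hlog
  rw [add_mul, mul_assoc, mutualInfo_mul_log_two, mutualInfo_mul_log_two, mutualInfo_mul_log_two,
    hminus, hplus, sum_negMulLog_plus]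
  ring

theorem mutualInfo_le_one (W : BinaryChannel.{u}) : W.mutualInfo ≤ 1 := by
  rw [mutualInfo_eq_sum]
  refine (sum_le_sum fun y _ => ?_).trans_eq W.sum_outputLaw
  have key : ∀ x, 1 / 2 * W.prob x y * Real.logb 2 (W.prob x y / W.outputLaw y)
      ≤ 1 / 2 * W.prob x y := by
    intro x
    rcases (W.prob_nonneg x y).eq_or_lt' with h | h
    · simp [h]
    · have hle := W.prob_le_two_mul_outputLaw x y
      have ho : 0 < W.outputLaw y := by linarith
      refine mul_le_of_le_one_right (by positivity) ?_
      rw [Real.logb_le_iff_le_rpow (by norm_num) (div_pos h ho), Real.rpow_one, div_le_iff₀ ho]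
      exact hle
  calc _ ≤ ∑ x, 1 / 2 * W.prob x y := sum_le_sum fun x _ => key x
    _ = W.outputLaw y := rfl

/-- Per output letter, the Kullback–Leibler divergence is at most the `χ²` divergence, which in turn
is at most `a + b - 2 √(a b) = (√a - √b)²`. -/
theorem sum_mul_log_le (W : BinaryChannel.{u}) (y : W.Out) :
    ∑ x, 1 / 2 * W.prob x y * Real.log (W.prob x y / W.outputLaw y)
      ≤ 2 * W.outputLaw y - 2 * √(W.prob false y * W.prob true y) := by
  have key : ∀ x, 1 / 2 * W.prob x y * Real.log (W.prob x y / W.outputLaw y)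
      ≤ 1 / 2 * W.prob x y * (W.prob x y / W.outputLaw y - 1) := by
    intro x
    rcases (W.prob_nonneg x y).eq_or_lt' with h | h
    · simp [h]
    · have ho : 0 < W.outputLaw y := by linarith [W.prob_le_two_mul_outputLaw x y]
      gcongr
      exact Real.log_le_sub_one_of_pos (div_pos h ho)
  refine (sum_le_sum fun x _ => key x).trans ?_
  simp only [Fintype.sum_bool, outputLaw_eq]
  have ha := W.prob_nonneg false y
  have hb := W.prob_nonneg true y
  rw [Real.sqrt_mul ha]
  generalize W.prob false y = a at *
  generalize W.prob true y = b at *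
  obtain ⟨s, hs, rfl⟩ : ∃ s, 0 ≤ s ∧ s ^ 2 = a := ⟨√a, Real.sqrt_nonneg a, Real.sq_sqrt ha⟩
  obtain ⟨t, ht, rfl⟩ : ∃ t, 0 ≤ t ∧ t ^ 2 = b := ⟨√b, Real.sqrt_nonneg b, Real.sq_sqrt hb⟩
  rw [Real.sqrt_sq hs, Real.sqrt_sq ht]
  rcases (add_nonneg ha hb).eq_or_lt' with h | h
  · have h1 : s = 0 := by nlinarith
    have h2 : t = 0 := by nlinarith
    simp [h1, h2]
  · have e : 1 / 2 * t ^ 2 * (t ^ 2 / ((s ^ 2 + t ^ 2) / 2) - 1)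
        + 1 / 2 * s ^ 2 * (s ^ 2 / ((s ^ 2 + t ^ 2) / 2) - 1)
        = (s ^ 2 - t ^ 2) ^ 2 / (2 * (s ^ 2 + t ^ 2)) := by
      field_simp
      ring
    rw [e, div_le_iff₀ (by positivity)]
    nlinarith [sq_nonneg ((s - t) * (s - t))]

theorem mutualInfo_le_four_mul (W : BinaryChannel.{u}) (hZ : W.bhattacharyya ≤ 1) :
    W.mutualInfo ≤ 4 * (1 - W.bhattacharyya) := by
  have hlog : 1 / 2 < Real.log 2 := by linarith [Real.log_two_gt_d9]
  have h : W.mutualInfo * Real.log 2 ≤ 2 - 2 * W.bhattacharyya := by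
    have e : (2 : ℝ) - 2 * W.bhattacharyya
        = ∑ y, (2 * W.outputLaw y - 2 * √(W.prob false y * W.prob true y)) := by
      rw [sum_sub_distrib, ← mul_sum, ← mul_sum, W.sum_outputLaw, bhattacharyya, mul_one]
    rw [e, mutualInfo_eq_sum, sum_mul]
    refine sum_le_sum fun y _ => (le_of_eq ?_).trans (W.sum_mul_log_le y)
    rw [sum_mul]
    refine sum_congr rfl fun x _ => ?_
    rw [Real.logb, mul_assoc, div_mul_cancel₀ _ (by linarith)]
  by_contra! hc
  nlinarith

/-! ### The Bhattacharyya parameter -/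

theorem bhattacharyya_nonneg (W : BinaryChannel.{u}) : 0 ≤ W.bhattacharyya :=
  sum_nonneg fun _ _ => Real.sqrt_nonneg _

theorem sqrt_prob_le_outputLaw (W : BinaryChannel.{u}) (y : W.Out) :
    √(W.prob false y * W.prob true y) ≤ W.outputLaw y := by
  refine Real.sqrt_le_iff.mpr ⟨W.outputLaw_nonneg y, ?_⟩
  rw [outputLaw_eq]
  nlinarith [sq_nonneg (W.prob false y - W.prob true y)]

theorem bhattacharyya_le_one (W : BinaryChannel.{u}) : W.bhattacharyya ≤ 1 := by
  rw [← W.sum_outputLaw]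
  exact sum_le_sum fun y _ => W.sqrt_prob_le_outputLaw y

theorem bhattacharyya_plus (W : BinaryChannel.{u}) :
    W.plus.bhattacharyya = W.bhattacharyya ^ 2 := by
  have key : ∀ (y₁ y₂ : W.Out) (c : Bool),
      √(1 / 2 * W.prob (xor c false) y₁ * W.prob false y₂
          * (1 / 2 * W.prob (xor c true) y₁ * W.prob true y₂))
        = 1 / 2 * (√(W.prob false y₁ * W.prob true y₁) * √(W.prob false y₂ * W.prob true y₂)) := by
    intro y₁ y₂ c
    have h0 := mul_nonneg (W.prob_nonneg false y₁) (W.prob_nonneg true y₁)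
    rw [← Real.sqrt_mul h0, ← Real.sqrt_sq (by norm_num : (0 : ℝ) ≤ 1 / 2),
      ← Real.sqrt_mul (by norm_num)]
    congr 1
    cases c <;> simp only [Bool.xor_true, Bool.xor_false, Bool.not_true, Bool.not_false] <;>
      rw [Real.sqrt_sq (by norm_num)] <;> ring
  change ∑ y : W.Out × W.Out × Bool,
      √(1 / 2 * W.prob (xor y.2.2 false) y.1 * W.prob false y.2.1
          * (1 / 2 * W.prob (xor y.2.2 true) y.1 * W.prob true y.2.1)) = _
  simp only [Fintype.sum_prod_type, key, Fintype.sum_bool, ← two_mul]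
  rw [bhattacharyya, sq, sum_mul_sum]
  refine sum_congr rfl fun y₁ _ => sum_congr rfl fun y₂ _ => ?_
  ring

/-- With `q` the output law and `z = √(W(y|0) W(y|1))`, the term of `Z(W⁻)` at `(y₁, y₂)` is
`√(z₁² q₂² + z₂² (q₁² - z₁²))`. -/
theorem bhattacharyya_minus (W : BinaryChannel.{u}) :
    W.minus.bhattacharyya = ∑ y₁, ∑ y₂,
      √((√(W.prob false y₁ * W.prob true y₁) * W.outputLaw y₂) ^ 2
        + √(W.prob false y₂ * W.prob true y₂) ^ 2
          * (W.outputLaw y₁ ^ 2 - √(W.prob false y₁ * W.prob true y₁) ^ 2)) := by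
  change ∑ y : W.Out × W.Out, √(W.minus.prob false y * W.minus.prob true y) = _
  rw [Fintype.sum_prod_type]
  refine sum_congr rfl fun y₁ _ => sum_congr rfl fun y₂ _ => ?_
  congr 1
  rw [mul_pow, Real.sq_sqrt (mul_nonneg (W.prob_nonneg _ _) (W.prob_nonneg _ _)),
    Real.sq_sqrt (mul_nonneg (W.prob_nonneg _ _) (W.prob_nonneg _ _))]
  simp only [outputLaw_eq, minus, Fintype.sum_bool, Bool.xor_true, Bool.xor_false, Bool.not_true,
    Bool.not_false]
  ring

theorem bhattacharyya_minus_le (W : BinaryChannel.{u}) :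
    W.minus.bhattacharyya ≤ 2 * W.bhattacharyya - W.bhattacharyya ^ 2 := by
  have e : 2 * W.bhattacharyya - W.bhattacharyya ^ 2 = ∑ y₁, ∑ y₂,
      (√(W.prob false y₁ * W.prob true y₁) * W.outputLaw y₂
        + W.outputLaw y₁ * √(W.prob false y₂ * W.prob true y₂)
        - √(W.prob false y₁ * W.prob true y₁) * √(W.prob false y₂ * W.prob true y₂)) := by
    simp only [sum_add_distrib, sum_sub_distrib, ← mul_sum, ← sum_mul, W.sum_outputLaw]
    simp only [bhattacharyya]
    ring
  rw [bhattacharyya_minus, e]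
  refine sum_le_sum fun y₁ _ => sum_le_sum fun y₂ _ => ?_
  have h1 := W.sqrt_prob_le_outputLaw y₁
  have h2 := W.sqrt_prob_le_outputLaw y₂
  have h3 := Real.sqrt_nonneg (W.prob false y₁ * W.prob true y₁)
  have h4 := Real.sqrt_nonneg (W.prob false y₂ * W.prob true y₂)
  generalize √(W.prob false y₁ * W.prob true y₁) = z₁ at *
  generalize √(W.prob false y₂ * W.prob true y₂) = z₂ at *
  generalize W.outputLaw y₁ = q₁ at *
  generalize W.outputLaw y₂ = q₂ at *
  refine Real.sqrt_le_iff.mpr ⟨?_, ?_⟩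
  · nlinarith [mul_nonneg h3 (sub_nonneg.mpr h2), mul_nonneg (h3.trans h1) h4]
  · -- the difference of the two sides is `2 z₁ z₂ (q₁ - z₁) (q₂ - z₂)`
    nlinarith [mul_nonneg (mul_nonneg h3 h4) (mul_nonneg (sub_nonneg.mpr h1) (sub_nonneg.mpr h2))]

/-- Minkowski's inequality in the Euclidean plane. -/
theorem sqrt_sum_sq_add_sum_sq_le {α : Type*} [Fintype α] (u v : α → ℝ) :
    √((∑ i, u i) ^ 2 + (∑ i, v i) ^ 2) ≤ ∑ i, √(u i ^ 2 + v i ^ 2) := by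
  have h := norm_sum_le univ fun i => (⟨u i, v i⟩ : ℂ)
  simpa only [Complex.norm_eq_sqrt_sq_add_sq, Complex.re_sum, Complex.im_sum] using h

theorem le_bhattacharyya_minus (W : BinaryChannel.{u}) :
    W.bhattacharyya * √(2 - W.bhattacharyya ^ 2) ≤ W.minus.bhattacharyya := by
  have hZ0 := W.bhattacharyya_nonneg
  have hZ1 := W.bhattacharyya_le_one
  have hZ : 0 ≤ 1 - W.bhattacharyya ^ 2 := by nlinarith
  -- Minkowski over `y₂` for fixed `y₁`
  have inner_le : ∀ y₁, √((√(W.prob false y₁ * W.prob true y₁) * √(1 - W.bhattacharyya ^ 2)) ^ 2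
        + (W.bhattacharyya * W.outputLaw y₁) ^ 2)
      ≤ ∑ y₂, √((√(W.prob false y₁ * W.prob true y₁) * W.outputLaw y₂) ^ 2
        + √(W.prob false y₂ * W.prob true y₂) ^ 2
          * (W.outputLaw y₁ ^ 2 - √(W.prob false y₁ * W.prob true y₁) ^ 2)) := by
    intro y₁
    have h1 := W.sqrt_prob_le_outputLaw y₁
    have h3 := Real.sqrt_nonneg (W.prob false y₁ * W.prob true y₁)
    have hd : 0 ≤ W.outputLaw y₁ ^ 2 - √(W.prob false y₁ * W.prob true y₁) ^ 2 := by nlinarith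
    have h := sqrt_sum_sq_add_sum_sq_le
      (fun y₂ => √(W.prob false y₁ * W.prob true y₁) * W.outputLaw y₂)
      (fun y₂ => √(W.prob false y₂ * W.prob true y₂)
        * √(W.outputLaw y₁ ^ 2 - √(W.prob false y₁ * W.prob true y₁) ^ 2))
    simp only [mul_pow _ (√(_ - _)), Real.sq_sqrt hd, ← mul_sum, ← sum_mul, W.sum_outputLaw] at h
    refine (le_of_eq ?_).trans h
    congr 1
    rw [mul_pow _ (√(1 - _)), Real.sq_sqrt hZ, bhattacharyya]
    ring
  -- Minkowski over `y₁`
  have outer := sqrt_sum_sq_add_sum_sq_le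
    (fun y => √(W.prob false y * W.prob true y) * √(1 - W.bhattacharyya ^ 2))
    (fun y => W.bhattacharyya * W.outputLaw y)
  rw [bhattacharyya_minus]
  refine le_trans (le_trans (le_of_eq ?_) outer) (sum_le_sum fun y₁ _ => inner_le y₁)
  rw [← sum_mul, ← mul_sum, W.sum_outputLaw]
  change _ = √((W.bhattacharyya * _) ^ 2 + _)
  rw [mul_pow, Real.sq_sqrt hZ, ← Real.sqrt_sq hZ0, ← Real.sqrt_mul (sq_nonneg _),
    Real.sqrt_sq hZ0]
  congr 1
  ring

/-! ### Contraction of the potential -/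

/-- The potential `√(Z (1 - Z))`, which vanishes exactly at the two polarized values of `Z`. -/
noncomputable def potential (W : BinaryChannel.{u}) : ℝ :=
  √(W.bhattacharyya * (1 - W.bhattacharyya))

theorem potential_nonneg (W : BinaryChannel.{u}) : 0 ≤ W.potential :=
  Real.sqrt_nonneg _

theorem potential_le_half (W : BinaryChannel.{u}) : W.potential ≤ 1 / 2 := by
  refine Real.sqrt_le_iff.mpr ⟨by norm_num, ?_⟩
  nlinarith [sq_nonneg (W.bhattacharyya - 1 / 2)]

theorem potential_plus (W : BinaryChannel.{u}) :
    W.plus.potential = √(W.bhattacharyya * (1 + W.bhattacharyya)) * W.potential := by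
  have h0 := W.bhattacharyya_nonneg
  rw [potential, potential, bhattacharyya_plus, ← Real.sqrt_mul (by positivity)]
  congr 1
  ring

theorem potential_minus_le (W : BinaryChannel.{u}) :
    W.minus.potential
      ≤ √((2 - W.bhattacharyya) * (1 - W.bhattacharyya ^ 2)) * W.potential := by
  have h0 := W.bhattacharyya_nonneg
  have h1 := W.bhattacharyya_le_one
  have hup := W.bhattacharyya_minus_le
  have hlow := W.le_bhattacharyya_minus
  have hm := W.minus.bhattacharyya_le_one
  have hm0 := W.minus.bhattacharyya_nonneg
  rw [potential, potential]
  generalize W.bhattacharyya = z at *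
  generalize W.minus.bhattacharyya = w at *
  have hz : 0 ≤ 1 - z ^ 2 := by nlinarith
  rw [← Real.sqrt_mul (mul_nonneg (by linarith) hz)]
  refine Real.sqrt_le_sqrt ?_
  -- `s = z √(2 - z²)` satisfies `1 - s² = (1 - z²)²` and `s ≥ z`
  have hs2 : (z * √(2 - z ^ 2)) ^ 2 = z ^ 2 * (2 - z ^ 2) := by
    rw [mul_pow, Real.sq_sqrt (by linarith)]
  have hsz : z ≤ z * √(2 - z ^ 2) :=
    le_mul_of_one_le_right h0 (Real.one_le_sqrt.mpr (by linarith))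
  generalize z * √(2 - z ^ 2) = s at *
  have h1s : 1 - s ≤ (1 - z ^ 2) * (1 - z) := by
    have e : (1 - s) * (1 + s) = (1 - z ^ 2) * (1 - z) * (1 + z) := by linear_combination -hs2
    have hp : 0 ≤ (1 - z ^ 2) * (1 - z) := mul_nonneg hz (by linarith)
    by_contra! hc
    nlinarith
  calc w * (1 - w) ≤ (2 * z - z ^ 2) * ((1 - z ^ 2) * (1 - z)) :=
        mul_le_mul hup (by linarith) (by linarith) (by nlinarith)
    _ = (2 - z) * (1 - z ^ 2) * (z * (1 - z)) := by ring

/-- With `a = z (1 + z)` and `b = (2 - z) (1 - z²)` one has `a + b ≤ 2` and `4 a b ≤ 1.9²`, so that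
`(√a + √b)² ≤ 3.9 = 4 · (39/40)`. -/
theorem sqrt_add_sqrt_le {z : ℝ} (h0 : 0 ≤ z) (h1 : z ≤ 1) :
    √(z * (1 + z)) + √((2 - z) * (1 - z ^ 2)) ≤ 2 * √(39 / 40) := by
  have ha : 0 ≤ z * (1 + z) := by positivity
  have hz : 0 ≤ 1 - z ^ 2 := by nlinarith
  have hb : 0 ≤ (2 - z) * (1 - z ^ 2) := mul_nonneg (by linarith) hz
  have hcubic : z * (1 - z ^ 2) ≤ 401 / 1000 := by
    nlinarith [mul_nonneg h0 (sq_nonneg (z - 58 / 100)), sq_nonneg (z - 58 / 100)]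
  have hab : z * (1 + z) * ((2 - z) * (1 - z ^ 2)) ≤ (19 / 20) ^ 2 := by
    have e : (1 + z) * (2 - z) ≤ 9 / 4 := by nlinarith [sq_nonneg (z - 1 / 2)]
    have hn : 0 ≤ z * (1 - z ^ 2) := mul_nonneg h0 hz
    nlinarith [mul_le_mul_of_nonneg_left e hn]
  have hsqrt : √(z * (1 + z)) * √((2 - z) * (1 - z ^ 2)) ≤ 19 / 20 := by
    rw [← Real.sqrt_mul ha]
    exact Real.sqrt_le_iff.mpr ⟨by norm_num, hab⟩
  refine abs_le_of_sq_le_sq' ?_ (by positivity) |>.2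
  rw [add_sq, mul_pow, Real.sq_sqrt ha, Real.sq_sqrt hb, Real.sq_sqrt (by norm_num)]
  nlinarith [mul_nonneg (mul_nonneg h0 h0) (sub_nonneg.mpr h1)]

theorem potential_minus_add_plus_le (W : BinaryChannel.{u}) :
    W.minus.potential + W.plus.potential ≤ 2 * √(39 / 40) * W.potential := by
  have h := mul_le_mul_of_nonneg_right
    (sqrt_add_sqrt_le W.bhattacharyya_nonneg W.bhattacharyya_le_one) W.potential_nonneg
  rw [potential_plus]
  linarith [W.potential_minus_le]

/-! ### Averages over the polarized channels -/

theorem sum_range_two_mul (f : ℕ → ℝ) (n : ℕ) :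
    ∑ i ∈ range (2 * n), f i = ∑ i ∈ range n, (f (2 * i) + f (2 * i + 1)) := by
  induction n with
  | zero => simp
  | succ k ih => rw [mul_add, mul_one, sum_range_succ, sum_range_succ, ih, sum_range_succ, add_assoc]

theorem sum_polar_succ (W : BinaryChannel.{u}) (f : BinaryChannel.{u} → ℝ) (n : ℕ) :
    ∑ i ∈ range (2 ^ (n + 1)), f (W.polar (n + 1) i)
      = ∑ i ∈ range (2 ^ n), (f (W.polar n i).minus + f (W.polar n i).plus) := by
  rw [pow_succ', sum_range_two_mul]
  refine sum_congr rfl fun i _ => ?_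
  have h1 : (2 * i + 1) / 2 = i := by omega
  have h2 : ¬ Even (2 * i + 1) := by simp
  simp [polar, h1, h2]

theorem sum_mutualInfo_polar (W : BinaryChannel.{u}) (n : ℕ) :
    ∑ i ∈ range (2 ^ n), (W.polar n i).mutualInfo = 2 ^ n * W.mutualInfo := by
  induction n with
  | zero => simp [polar]
  | succ n ih =>
    rw [W.sum_polar_succ]
    simp only [mutualInfo_minus_add_plus]
    rw [← mul_sum, ih]
    ring

theorem sum_potential_polar_le (W : BinaryChannel.{u}) (n : ℕ) :
    ∑ i ∈ range (2 ^ n), (W.polar n i).potential ≤ 2 ^ n * (√(39 / 40) ^ n / 2) := by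
  induction n with
  | zero => simpa [polar] using W.potential_le_half
  | succ n ih =>
    rw [W.sum_polar_succ]
    refine (sum_le_sum fun i _ => (W.polar n i).potential_minus_add_plus_le).trans ?_
    rw [← mul_sum]
    refine (mul_le_mul_of_nonneg_left ih (by positivity)).trans (le_of_eq ?_)
    ring

/-- A channel with `Z > 2 t` has `I² ≤ I ≤ 4 (1 - Z) ≤ 4 Z (1 - Z) / t`. -/
theorem mutualInfo_le_of_lt_bhattacharyya (W : BinaryChannel.{u}) {t : ℝ} (ht : 0 < t)
    (hZ : 2 * t < W.bhattacharyya) : W.mutualInfo ≤ 2 * W.potential / √t := by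
  have hI := W.mutualInfo_le_one
  have hI' := W.mutualInfo_le_four_mul W.bhattacharyya_le_one
  have h1 := W.bhattacharyya_le_one
  rcases le_or_gt W.mutualInfo 0 with h | h
  · exact h.trans (div_nonneg (mul_nonneg zero_le_two W.potential_nonneg) (Real.sqrt_nonneg t))
  · rw [le_div_iff₀ (Real.sqrt_pos.mpr ht)]
    refine abs_le_of_sq_le_sq' ?_ (mul_nonneg zero_le_two W.potential_nonneg) |>.2
    rw [mul_pow, mul_pow, Real.sq_sqrt ht.le, potential,
      Real.sq_sqrt (mul_nonneg W.bhattacharyya_nonneg (sub_nonneg.mpr h1))]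
    have hsq : W.mutualInfo ^ 2 ≤ 4 * (1 - W.bhattacharyya) := by nlinarith
    calc W.mutualInfo ^ 2 * t ≤ 4 * (1 - W.bhattacharyya) * W.bhattacharyya :=
          mul_le_mul hsq (by linarith) ht.le (by linarith)
      _ = 2 ^ 2 * (W.bhattacharyya * (1 - W.bhattacharyya)) := by ring

/-- The proportion of channels at depth `m` with `Z ≤ 2 t` is at least `I(W) - √(39/40) ^ m / √t`. -/
theorem mutualInfo_le_card_div_add (W : BinaryChannel.{u}) (m : ℕ) {t : ℝ} (ht : 0 < t) :
    W.mutualInfo ≤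
      (#{i ∈ range (2 ^ m) | (W.polar m i).bhattacharyya ≤ 2 * t} : ℝ) / 2 ^ m
        + √(39 / 40) ^ m / √t := by
  have hst : 0 < √t := Real.sqrt_pos.mpr ht
  have key : ∀ i, (W.polar m i).mutualInfo
      ≤ (if (W.polar m i).bhattacharyya ≤ 2 * t then 1 else 0)
        + 2 / √t * (W.polar m i).potential := by
    intro i
    have hp := mul_nonneg (div_nonneg zero_le_two hst.le) (W.polar m i).potential_nonneg
    split_ifs with h
    · linarith [(W.polar m i).mutualInfo_le_one]
    · have := (W.polar m i).mutualInfo_le_of_lt_bhattacharyya ht (not_le.mp h)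
      rw [zero_add, div_mul_eq_mul_div]
      exact this
  have hsum := sum_le_sum fun i (_ : i ∈ range (2 ^ m)) => key i
  rw [sum_add_distrib, ← mul_sum, sum_boole, sum_mutualInfo_polar] at hsum
  have hpot := mul_le_mul_of_nonneg_left (W.sum_potential_polar_le m)
    (div_nonneg zero_le_two hst.le)
  have h2 : (0 : ℝ) < 2 ^ m := by positivity
  have e : 2 / √t * (2 ^ m * (√(39 / 40) ^ m / 2)) = √(39 / 40) ^ m / √t * 2 ^ m := by ring
  rw [← sub_le_iff_le_add, le_div_iff₀ h2]
  linarith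

theorem sqrt_pow_div_sqrt_pow_le {a ρ ε : ℝ} (ha : 0 < a) (haρ : a < ρ) (hε : 0 < ε) {m : ℕ}
    (hm : 2 / Real.log (ρ / a) * Real.log (1 / ε) ≤ m) : √a ^ m / √(ρ ^ m) ≤ ε := by
  have hρ := ha.trans haρ
  have hl : 0 < Real.log (ρ / a) := Real.log_pos ((one_lt_div ha).mpr haρ)
  have hpos : 0 < √a ^ m / √(ρ ^ m) := by positivity
  rw [← Real.log_le_log_iff hpos hε, Real.log_div (by positivity) (by positivity), Real.log_pow,
    Real.log_sqrt ha.le, Real.log_sqrt (by positivity), Real.log_pow]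
  rw [div_mul_eq_mul_div, div_le_iff₀ hl, one_div, Real.log_inv,
    Real.log_div hρ.ne' ha.ne'] at hm
  linarith

end BinaryChannel

theorem propositionp :
    ∃ Λ : ℝ, 0 < Λ ∧ Λ < 1 ∧ ∀ ρ ∈ Set.Ioo Λ 1, ∃ b : ℝ, 0 < b ∧
      ∀ W : BinaryChannel.{u}, W.IsSymmetric → ∀ ε : ℝ, 0 < ε →
        ∀ m : ℕ, b * Real.log (1 / ε) ≤ (m : ℝ) →
          ∃ R : Set BinaryChannel.{u},
            R ⊆ {M | ∃ i : ℕ, i < 2 ^ m ∧ M = W.polar m i} ∧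
            (∀ M ∈ R, M.bhattacharyya ≤ 2 * ρ ^ m) ∧
            W.mutualInfo - ε ≤
              (Nat.card {i : Fin (2 ^ m) // W.polar m i ∈ R} : ℝ) / 2 ^ m := by
  refine ⟨39 / 40, by norm_num, by norm_num, fun ρ hρ => ?_⟩
  have hΛ : (0 : ℝ) < 39 / 40 := by norm_num
  have hρ0 : 0 < ρ := hΛ.trans hρ.1
  refine ⟨2 / Real.log (ρ / (39 / 40)),
    div_pos two_pos (Real.log_pos ((one_lt_div hΛ).mpr hρ.1)), ?_⟩
  intro W _ ε hε m hm
  refine ⟨{M | (∃ i : ℕ, i < 2 ^ m ∧ M = W.polar m i) ∧ M.bhattacharyya ≤ 2 * ρ ^ m},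
    fun M hM => hM.1, fun M hM => hM.2, ?_⟩
  have hcard : Nat.card {i : Fin (2 ^ m) // W.polar m i ∈
      {M | (∃ i : ℕ, i < 2 ^ m ∧ M = W.polar m i) ∧ M.bhattacharyya ≤ 2 * ρ ^ m}}
      = #{i ∈ range (2 ^ m) | (W.polar m i).bhattacharyya ≤ 2 * ρ ^ m} := by
    classical
    rw [Nat.card_eq_fintype_card, Fintype.card_subtype, card_filter, card_filter,
      ← Fin.sum_univ_eq_sum_range fun i => if (W.polar m i).bhattacharyya ≤ 2 * ρ ^ m then 1 else 0]
    refine sum_congr rfl fun i _ => if_congr ?_ rfl rfl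
    exact ⟨fun h => h.2, fun h => ⟨⟨i, i.2, rfl⟩, h⟩⟩
  rw [hcard]
  have h1 := W.mutualInfo_le_card_div_add m (pow_pos hρ0 m)
  have h2 := BinaryChannel.sqrt_pow_div_sqrt_pow_le hΛ hρ.1 hε hm
  linarith
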